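/- **Setting.** A *model* with $n$ latent and $d$ observed variables over a family of domains $u$ consists of: a mixing function $g:\mathbb{R}^n\to\mathbb{R}^d$ which is a $\mathcal{C}^2$-diffeomorphism onto its image; an acyclic structural equation model $Z_i=f_i(\mathrm{PA}(Z_i),\epsilon_i;\theta_i)$, $i=1,\dots,n$, with measurable $f_i$ and mutually independent noises $\epsilon_i$; a parameter vector $\theta^{(u)}=(\theta^{(u)}_1,\dots,\theta^{(u)}_n)$ for each domain $u$; and a density $p_Z(\cdot\,;\theta^{(u)})$ of $Z$ for each $u$. The observed variables are $X=g(Z)$, and $p_X(\cdot\,;\theta^{(u)})$ denotes their density with respect to $n$-dimensional volume, that is, $p_X(g(z);\theta^{(u)})=p_Z(z;\theta^{(u)})/\sqrt{\det(J_g(z)^{\top}J_g(z))}$ on the image of $g$ and $0$ elsewhere. The Markov network $\mathcal{M}_Z$ is the undirected graph on $\{Z_1,\dots,Z_n\}$ in which $Z_i,Z_j$ ($i\ne j$) are non-adjacent if and only if $Z_i$ and $Z_j$ are conditionally independent given the remaining variables in every domain; $|\mathcal{M}_Z|$ is its number of edges. Let a true model $(g,f,p_Z,\Theta)$ be given, where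 $\Theta$ is the family of the $\theta^{(u)}$, and assume: * **A1.** For every domain, $p_Z$ is twice continuously differentiable and positive on $\mathbb{R}^n$. * **A2.** For each $z\in\mathbb{R}^n$ there are $2n+|\mathcal{M}_Z|+1$ members $\theta^{(u)}$ of $\Theta$, $u=0,\dots,2n+|\mathcal{M}_Z|$, such that the vectors $w(z,u)-w(z,0)$, $u=1,\dots,2n+|\mathcal{M}_Z|$, are linearly independent, where $$w(z,u)=\Big(\tfrac{\partial \log p_Z(z;\theta^{(u)})}{\partial z_i}\Big)_{i}\oplus\Big(\tfrac{\partial^2 \log p_Z(z;\theta^{(u)})}{\partial z_i^2}\Big)_{i}\oplus\Big(\tfrac{\partial^2 \log p_Z(z;\theta^{(u)})}{\partial z_i\partial z_j}\Big)_{i<j,\ \{Z_i,Z_j\}\in\mathcal{E}(\mathcal{M}_Z)} .$$ Let $(\hat g,\hat f,p_{\hat Z},\hat\Theta)$ be an estimated model (with the same $n$, $d$ and domains) that matches the true one, i.e. $p_{\hat X}(x;\hat\theta^{(u)})=p_X(x;\theta^{(u)})$ for all domains $u$ and all $x$ in the image of $g$, and whose Markov network $\mathcal{M}_{\hat Z}$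 has the minimal number of edges among all models that match the true one. Let $Z=v(\hat Z)$ with $v=g^{-1}\circ\hat g$, defined on the open set $\hat g^{-1}(g(\mathbb{R}^n))$. Say that $Z_i$ *is a function of* $\hat Z_k$ if $v_i$ is non-constant along some segment in this set on which only the $k$-th coordinate varies; equivalently, if $\partial Z_i/\partial\hat Z_k$ does not vanish identically. **Theorem (Relations among true and recovered latent causal variables).** For every pair $\hat Z_k,\hat Z_l$ ($k\neq l$) that is non-adjacent in $\mathcal{M}_{\hat Z}$: * (a) Each true latent variable $Z_i$ is a function of at most one of $\hat Z_k$ and $\hat Z_l$. * (b) For each pair $Z_i,Z_j$ that is adjacent in $\mathcal{M}_Z$, at most one of the two statements "$Z_i$ is a function of $\hat Z_k$" and "$Z_j$ is a function of $\hat Z_l$" holds, and at most one of the two statements "$Z_i$ is a function of $\hat Z_l$" and "$Z_j$ is a function of $\hat Z_k$" holds. -/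

import Mathlib

open MeasureTheory ProbabilityTheory Set Function

namespace CausalRep

/-- A generating model with `n` latent and `d` observed variables, over a family of domains indexed
by `ι`: the mixing `X = g(Z)` together with an acyclic structural equation model
`Z_i = f_i(PA(Z_i), ε_i; θ_i)` with mutually independent noises `ε_i`, the parameter vector
`θ u = (θ_1, …, θ_n)` of each domain `u`, and (see `Model`) the densities of `Z`. -/
structure SEM (ι : Type*) (n d : ℕ) where
  /-- the mixing function -/
  g : (Fin n → ℝ) → (Fin d → ℝ)
  /-- `g` is a `C²`-diffeomorphism onto its image: a `C²` immersion and a homeomorphism onto its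
  image -/
  g_contDiff : ContDiff ℝ 2 g
  g_immersion : ∀ z, Injective (fderiv ℝ g z)
  g_embedding : Topology.IsEmbedding g
  /-- `pa i` is the set of (indices of) parents of `Z_i` -/
  pa : Fin n → Finset (Fin n)
  /-- the causal graph has no directed cycle -/
  acyclic : ∀ i, ¬ Relation.TransGen (fun j i => j ∈ pa i) i i
  /-- the laws of the noises -/
  noise : Fin n → ProbabilityMeasure ℝ
  /-- the space in which the latent factor `θ_i` takes its values -/
  Param : Fin n → Type
  /-- the latent factors of each domain -/
  θ : ι → ∀ i, Param i
  /-- the structural functions -/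
  f : ∀ i, (pa i → ℝ) → ℝ → Param i → ℝ
  f_measurable : ∀ i t, Measurable fun x : (pa i → ℝ) × ℝ => f i x.1 x.2 t

namespace SEM

variable {ι : Type*} {n d : ℕ} (M : SEM ι n d)

theorem wf : WellFounded fun j i => j ∈ M.pa i := by
  have h : WellFounded (Relation.TransGen fun j i => j ∈ M.pa i) :=
    haveI : Std.Irrefl (Relation.TransGen fun j i => j ∈ M.pa i) := ⟨M.acyclic⟩
    Finite.wellFounded_of_trans_of_irrefl _
  exact Subrelation.wf (fun hji => Relation.TransGen.single hji) h

/-- The solution `Z` of the structural equations in domain `u`, as a function of the noises. -/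
noncomputable def solve (u : ι) (ε : Fin n → ℝ) : Fin n → ℝ :=
  M.wf.fix fun i Z => M.f i (fun j => Z j j.2) (ε i) (M.θ u i)

theorem solve_eq (u : ι) (ε : Fin n → ℝ) (i : Fin n) :
    M.solve u ε i = M.f i (fun j => M.solve u ε j) (ε i) (M.θ u i) :=
  M.wf.fix_eq _ i

theorem measurable_solve (u : ι) : Measurable (M.solve u) := by
  refine measurable_pi_lambda _ fun i => ?_
  induction i using M.wf.induction with
  | _ i ih =>
    simp_rw [M.solve_eq u _ i]
    exact (M.f_measurable i (M.θ u i)).comp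
      ((measurable_pi_lambda _ fun j : M.pa i => ih j.1 j.2).prodMk (measurable_pi_apply i))

/-- The law `P_{Z;θ}` of the latent variables in domain `u`. -/
noncomputable def law (u : ι) : Measure (Fin n → ℝ) :=
  (Measure.pi fun i => (M.noise i : Measure ℝ)).map (M.solve u)

instance (u : ι) : IsProbabilityMeasure (M.law u) :=
  Measure.isProbabilityMeasure_map (M.measurable_solve u).aemeasurable

end SEM

/-- The σ-algebra generated by the coordinates in `S`. -/
@[reducible] def coordAlgebra {n : ℕ} (S : Finset (Fin n)) : MeasurableSpace (Fin n → ℝ) :=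
  MeasurableSpace.comap (fun z (m : S) => z m) inferInstance

theorem coordAlgebra_le {n : ℕ} (S : Finset (Fin n)) :
    coordAlgebra S ≤ (inferInstance : MeasurableSpace (Fin n → ℝ)) :=
  Measurable.comap_le (measurable_pi_lambda _ fun _ => measurable_pi_apply _)

/-- Under the law `P` of `Z`, the variables `Z_i` and `Z_j` are conditionally independent given all
the other ones. -/
def CondIndepGivenRest {n : ℕ} (P : Measure (Fin n → ℝ)) [IsFiniteMeasure P] (i j : Fin n) : Prop :=
  CondIndepFun (coordAlgebra {i, j}ᶜ) (coordAlgebra_le {i, j}ᶜ) (fun z => z i) (fun z => z j) P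

theorem CondIndepGivenRest.symm {n : ℕ} {P : Measure (Fin n → ℝ)} [IsFiniteMeasure P] {i j : Fin n}
    (h : CondIndepGivenRest P i j) : CondIndepGivenRest P j i := by
  have h' := CondIndepFun.symm h
  unfold CondIndepGivenRest
  convert h' using 3 <;> rw [Finset.pair_comm]

/-- A structural equation model with mixing, together with densities `p u = p_Z(·; θ^{(u)})` of the
latent variables with respect to Lebesgue measure. -/
structure Model (ι : Type*) (n d : ℕ) extends SEM ι n d where
  p : ι → (Fin n → ℝ) → ℝ
  p_measurable : ∀ u, Measurable (p u)
  p_nonneg : ∀ u z, 0 ≤ p u z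
  p_density : ∀ u, toSEM.law u = volume.withDensity fun z => ENNReal.ofReal (p u z)

/-- The partial derivative `∂h/∂z_i`. -/
noncomputable def pderiv {n : ℕ} (i : Fin n) (h : (Fin n → ℝ) → ℝ) (z : Fin n → ℝ) : ℝ :=
  fderiv ℝ h z (Pi.single i 1)

/-- The `n`-dimensional volume factor `√det(Jᵀ J)` of `g` at `z`, `J` the Jacobian matrix. -/
noncomputable def volFactor {n d : ℕ} (g : (Fin n → ℝ) → (Fin d → ℝ)) (z : Fin n → ℝ) : ℝ :=
  let J : Matrix (Fin d) (Fin n) ℝ := LinearMap.toMatrix' (fderiv ℝ g z : (Fin n → ℝ) →ₗ[ℝ] _)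
  Real.sqrt (J.transpose * J).det

namespace Model

variable {ι : Type*} {n d : ℕ} (M : Model ι n d)

/-- The Markov network over the latent variables: `Z_i` and `Z_j` are adjacent unless they are
conditionally independent given the other variables, in all domains. -/
def markovNetwork : SimpleGraph (Fin n) where
  Adj i j := i ≠ j ∧ ∃ u, ¬ CondIndepGivenRest (M.law u) i j
  symm := ⟨fun _ _ ⟨hij, u, hu⟩ => ⟨hij.symm, u, fun h => hu h.symm⟩⟩
  loopless := ⟨fun _ h => h.1 rfl⟩

/-- The number of edges of the Markov network. -/
noncomputable def numEdges : ℕ := M.markovNetwork.edgeSet.ncard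

/-- The density `p_X(·; θ^{(u)})` of `X = g(Z)` in domain `u`, with respect to `n`-dimensional
volume (if `d = n`, Lebesgue measure): `p_Z(z) / √det(Jᵀ J)` at `x = g(z)`, and `0` outside the image
of `g`. -/
noncomputable def obsDensity (u : ι) (x : Fin d → ℝ) : ℝ :=
  open Classical in
  if x ∈ range M.g then M.p u (invFun M.g x) / volFactor M.g (invFun M.g x) else 0

/-- The model `M'` matches the distributions of the observed variables of `M`, in all domains. -/
def Matches (M' M : Model ι n d) : Prop :=
  ∀ u, ∀ x ∈ range M.g, M.obsDensity u x = M'.obsDensity u x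

/-- `M'` matches the distributions of `M`, with the minimal number of edges of its Markov network
among all the models that do. -/
def IsMinimalMatch (M' M : Model ι n d) : Prop :=
  M'.Matches M ∧ ∀ M'' : Model ι n d, M''.Matches M → M'.numEdges ≤ M''.numEdges

/-- Smooth and positive density. -/
def SmoothPositive : Prop :=
  ∀ u, ContDiff ℝ 2 (M.p u) ∧ ∀ z, 0 < M.p u z

/-- The vector `w(z, u)`: the first derivatives of `log p(·; θ^{(u)})`, its second derivatives in
single variables, and its mixed second derivatives along the edges `i < j` of the Markov network. -/
noncomputable def w (z : Fin n → ℝ) (u : ι) :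
    Fin n ⊕ Fin n ⊕ {e : Fin n × Fin n // M.markovNetwork.Adj e.1 e.2 ∧ e.1 < e.2} → ℝ
  | .inl i => pderiv i (fun y => Real.log (M.p u y)) z
  | .inr (.inl i) => pderiv i (pderiv i fun y => Real.log (M.p u y)) z
  | .inr (.inr e) => pderiv e.1.1 (pderiv e.1.2 fun y => Real.log (M.p u y)) z

/-- Sufficient changes. -/
def SufficientChanges : Prop :=
  ∀ z, ∃ θ : Fin (2 * n + M.numEdges + 1) → ι,
    LinearIndependent ℝ fun u : Fin (2 * n + M.numEdges) => M.w z (θ u.succ) - M.w z (θ 0)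

/-- The set of values `ẑ` of the recovered latent variables which correspond to a value of the true
ones, i.e. for which there is `z` with `ĝ(ẑ) = g(z)`. -/
def recoveredDomain (M M' : Model ι n d) : Set (Fin n → ℝ) := M'.g ⁻¹' range M.g

/-- The true latent variables as a function of the recovered ones: `Z = (g⁻¹ ∘ ĝ)(Ẑ)`. -/
noncomputable def trueOfRecovered (M M' : Model ι n d) (z' : Fin n → ℝ) : Fin n → ℝ :=
  invFun M.g (M'.g z')

/-- The true latent variable `Z_i` is a function of the recovered one `Ẑ_k`: its value changes along
some segment (inside the domain of `g⁻¹ ∘ ĝ`) on which only `Ẑ_k` varies. As `g⁻¹ ∘ ĝ` is `C²`, this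
says that `∂Z_i/∂Ẑ_k` does not vanish identically. -/
def IsFunctionOf (M M' : Model ι n d) (i k : Fin n) : Prop :=
  ∃ (x : Fin n → ℝ) (t : ℝ), segment ℝ x (update x k t) ⊆ recoveredDomain M M' ∧
    trueOfRecovered M M' (update x k t) i ≠ trueOfRecovered M M' x i

end Model

end CausalRep

/-! Write `v` for the map from recovered to true latents. Conditional independence of `Ẑ_k` and
`Ẑ_l` given the rest forces the cross-ratio identity for the recovered density at four corners where
it is continuous (`CondIndepGivenRest.density_mul_density`). By matching, this density is the true
density at `v` times a ratio of volume factors that does not depend on the domain. Differences of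
log-densities between two domains are therefore `C²` with vanishing mixed derivative in `k`, `l`.
Expanding by the chain rule gives a linear relation between the differences of the vectors `w`, with
the same coefficients for all domains; A2 makes every coefficient zero (`mixedCoeff_eq_zero`).
Hence, at each point, `∂Z_i/∂Ẑ_k · ∂Z_j/∂Ẑ_l = 0` whenever `i = j` or `Z_i`, `Z_j` are adjacent.

This is not yet enough: the two derivatives could be nonzero at different points. The remaining
argument is combinatorial. Since the Jacobian is invertible, some permutation `ρ` picks nonzero
entries `(ρ m, m)`; the pointwise relations and minimality of the edge count make `ρ` a graph
isomorphism. A nonzero entry `(i, k)` forces the closed neighborhood of `ρ⁻¹ i` into that of `k`. So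
the closed neighborhood of `ρ⁻¹ i` does not depend on the choice of `ρ`; it is locally constant by
continuity, hence constant on the connected domain of `v`. This links entries at different points
(`eq_or_adj_of_isPreconnected`). -/

namespace CausalRep

/-! ### Conditional independence expressed through integrals over fibers. -/

section Fiber

open scoped ENNReal

variable {Ω X Y : Type*} [mΩ : MeasurableSpace Ω] [mX : MeasurableSpace X] [MeasurableSpace Y]

/-- The integral of `q` over the part of `A` that lies in the fiber over `x` of the first component
of `e`. -/
noncomputable def fiberIntegral (e : Ω ≃ᵐ X × Y) (ν : Measure Y) (q : Ω → ℝ≥0∞) (A : Set Ω)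
    (x : X) : ℝ≥0∞ :=
  ∫⁻ y, A.indicator q (e.symm (x, y)) ∂ν

variable (e : Ω ≃ᵐ X × Y) {ρ : Measure Ω} {μ : Measure X} {ν : Measure Y}
  {q : Ω → ℝ≥0∞}

theorem measurable_fiberIntegral [SFinite ν] (hq : Measurable q) {A : Set Ω} (hA : MeasurableSet A) :
    Measurable (fiberIntegral e ν q A) :=
  Measurable.lintegral_prod_right' (f := fun z : X × Y => A.indicator q (e.symm z))
    ((hq.indicator hA).comp e.symm.measurable)

/-- Tonelli in the split coordinates. For `A = univ` it says that the fiber integral is the density,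
with respect to `μ`, of the marginal law of the first component. -/
theorem setLIntegral_fiberIntegral [SFinite μ] [SFinite ν] (he : MeasurePreserving e ρ (μ.prod ν))
    (hq : Measurable q) {A : Set Ω} (hA : MeasurableSet A) {f : X → ℝ≥0∞} (hf : Measurable f) :
    ∫⁻ x, f x * fiberIntegral e ν q A x ∂μ
      = ∫⁻ ω in A, f (e ω).1 ∂(ρ.withDensity q) := by
  have hF : Measurable fun z : X × Y => f z.1 * A.indicator q (e.symm z) :=
    (hf.comp measurable_fst).mul ((hq.indicator hA).comp e.symm.measurable)
  have h1 : ∀ x, f x * fiberIntegral e ν q A x = ∫⁻ y, f x * A.indicator q (e.symm (x, y)) ∂ν := by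
    intro x
    rw [fiberIntegral, lintegral_const_mul]
    exact ((hq.indicator hA).comp e.symm.measurable).comp measurable_prodMk_left
  simp_rw [h1]
  rw [← lintegral_prod (fun z : X × Y => f z.1 * A.indicator q (e.symm z)) hF.aemeasurable,
    ← he.lintegral_comp hF, restrict_withDensity hA,
    lintegral_withDensity_eq_lintegral_mul _ hq
      (g := fun ω => f (e ω).1) (hf.comp (measurable_fst.comp e.measurable)),
    ← lintegral_indicator hA]
  refine lintegral_congr fun ω => ?_
  by_cases h : ω ∈ A <;> simp [h, mul_comm]

/-- The fiber integrals represent the conditional probability given the first component of `e`. -/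
theorem exists_condExp_eq_fiberIntegral [SigmaFinite μ] [SFinite ν]
    (he : MeasurePreserving e ρ (μ.prod ν)) (hq : Measurable q)
    {P : Measure Ω} (hP : P = ρ.withDensity q) [IsFiniteMeasure P]
    {A : Set Ω} (hA : MeasurableSet A) :
    ∃ ψ : X → ℝ≥0∞, Measurable ψ ∧
      (∀ ω, ENNReal.ofReal ((P⟦A | mX.comap fun ω => (e ω).1⟧) ω) = ψ (e ω).1) ∧
      fiberIntegral e ν q A =ᵐ[μ] fun x => ψ x * fiberIntegral e ν q univ x := by
  have hR : Measurable fun ω => (e ω).1 := measurable_fst.comp e.measurable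
  have hm : mX.comap (fun ω => (e ω).1) ≤ mΩ := hR.comap_le
  have hint : Integrable (A.indicator fun _ => (1 : ℝ)) P := (integrable_const _).indicator hA
  obtain ⟨c, hc, hcR⟩ := (stronglyMeasurable_condExp (m := mX.comap fun ω => (e ω).1)
    (f := A.indicator fun _ => (1 : ℝ)) (μ := P)).measurable.exists_eq_measurable_comp
  refine ⟨fun x => ENNReal.ofReal (c x), hc.ennreal_ofReal, fun ω => ?_, ?_⟩
  · exact congrArg ENNReal.ofReal (congrFun hcR ω)
  -- Integrated over any `s`, both sides reduce to the defining property of the conditional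
  -- expectation on the preimage of `s`.
  refine ae_eq_of_forall_setLIntegral_eq_of_sigmaFinite (measurable_fiberIntegral e hq hA)
    (hc.ennreal_ofReal.mul (measurable_fiberIntegral e hq .univ)) fun s hs _ => ?_
  have hsR : MeasurableSet[mX.comap fun ω => (e ω).1] ((fun ω => (e ω).1) ⁻¹' s) := ⟨s, hs, rfl⟩
  have hnn : 0 ≤ᵐ[P] P⟦A | mX.comap fun ω => (e ω).1⟧ :=
    condExp_nonneg (.of_forall fun ω => indicator_nonneg (fun _ _ => zero_le_one) ω)
  have key := setIntegral_condExp hm hint hsR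
  have key' := congrArg ENNReal.ofReal key
  rw [ofReal_integral_eq_lintegral_ofReal integrable_condExp.integrableOn
    (ae_restrict_of_ae hnn), ofReal_integral_eq_lintegral_ofReal hint.integrableOn
    (.of_forall fun ω => indicator_nonneg (fun _ _ => zero_le_one) ω)] at key'
  have h1 := setLIntegral_fiberIntegral e he hq hA (f := s.indicator 1)
    (measurable_one.indicator hs)
  have h2 := setLIntegral_fiberIntegral e he hq .univ
    (f := s.indicator fun x => ENNReal.ofReal (c x)) (hc.ennreal_ofReal.indicator hs)
  rw [← lintegral_indicator hs, ← lintegral_indicator hs]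
  calc _ = ∫⁻ x, s.indicator 1 x * fiberIntegral e ν q A x ∂μ := by
        refine lintegral_congr fun x => ?_
        by_cases h : x ∈ s <;> simp [h]
    _ = ∫⁻ ω in (fun ω => (e ω).1) ⁻¹' s,
          ENNReal.ofReal (A.indicator (fun _ => (1 : ℝ)) ω) ∂P := by
        rw [h1, ← hP, ← lintegral_indicator hA, ← lintegral_indicator (hm _ hsR)]
        refine lintegral_congr fun ω => ?_
        by_cases h : ω ∈ A <;> by_cases h' : (e ω).1 ∈ s <;> simp [h, h']
    _ = ∫⁻ ω in univ, s.indicator (fun x => ENNReal.ofReal (c x)) (e ω).1 ∂P := by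
        rw [← key', ← lintegral_indicator (hm _ hsR), setLIntegral_univ]
        refine lintegral_congr fun ω => ?_
        rw [hcR]
        by_cases h' : (e ω).1 ∈ s <;> simp [h']
    _ = _ := by
        rw [hP, ← h2]
        refine lintegral_congr fun x => ?_
        by_cases h : x ∈ s <;> simp [h]

/-- Conditional independence given the first component of `e` makes the fiber integrals over
rectangles satisfy the cross-ratio identity. -/
theorem fiberIntegral_mul_fiberIntegral_of_condIndepFun [StandardBorelSpace Ω]
    [SigmaFinite μ] [SFinite ν]
    (he : MeasurePreserving e ρ (μ.prod ν)) (hq : Measurable q)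
    {P : Measure Ω} (hP : P = ρ.withDensity q) [IsFiniteMeasure P]
    (hm : mX.comap (fun ω => (e ω).1) ≤ mΩ) {f g : Ω → ℝ} (hf : Measurable f) (hg : Measurable g)
    (hfg : CondIndepFun (mX.comap fun ω => (e ω).1) hm f g P)
    {s₁ s₂ t₁ t₂ : Set ℝ} (hs₁ : MeasurableSet s₁) (hs₂ : MeasurableSet s₂)
    (ht₁ : MeasurableSet t₁) (ht₂ : MeasurableSet t₂) :
    ∀ᵐ x ∂μ, fiberIntegral e ν q (f ⁻¹' s₁ ∩ g ⁻¹' t₁) x * fiberIntegral e ν q (f ⁻¹' s₂ ∩ g ⁻¹' t₂) x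
      = fiberIntegral e ν q (f ⁻¹' s₁ ∩ g ⁻¹' t₂) x
        * fiberIntegral e ν q (f ⁻¹' s₂ ∩ g ⁻¹' t₁) x := by
  rw [condIndepFun_iff_condExp_inter_preimage_eq_mul hf hg] at hfg
  obtain ⟨ψ₁₁, m₁₁, e₁₁, h₁₁⟩ := exists_condExp_eq_fiberIntegral e he hq hP
    ((hf hs₁).inter (hg ht₁))
  obtain ⟨ψ₂₂, m₂₂, e₂₂, h₂₂⟩ := exists_condExp_eq_fiberIntegral e he hq hP
    ((hf hs₂).inter (hg ht₂))
  obtain ⟨ψ₁₂, m₁₂, e₁₂, h₁₂⟩ := exists_condExp_eq_fiberIntegral e he hq hP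
    ((hf hs₁).inter (hg ht₂))
  obtain ⟨ψ₂₁, m₂₁, e₂₁, h₂₁⟩ := exists_condExp_eq_fiberIntegral e he hq hP
    ((hf hs₂).inter (hg ht₁))
  have hnn : ∀ A : Set Ω, 0 ≤ᵐ[P] P⟦A | mX.comap fun ω => (e ω).1⟧ := fun A =>
    condExp_nonneg (.of_forall fun ω => indicator_nonneg (fun _ _ => zero_le_one) ω)
  -- Each of the four conditional probabilities factors, so both sides are the same product of four
  -- factors.
  have hae : ∀ᵐ ω ∂P, ψ₁₁ (e ω).1 * ψ₂₂ (e ω).1 = ψ₁₂ (e ω).1 * ψ₂₁ (e ω).1 := by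
    filter_upwards [hfg s₁ t₁ hs₁ ht₁, hfg s₂ t₂ hs₂ ht₂, hfg s₁ t₂ hs₁ ht₂, hfg s₂ t₁ hs₂ ht₁,
      hnn (f ⁻¹' s₁), hnn (f ⁻¹' s₂)] with ω a b c d n₁ n₂
    rw [← e₁₁, ← e₂₂, ← e₁₂, ← e₂₁, a, b, c, d]
    rw [ENNReal.ofReal_mul n₁, ENNReal.ofReal_mul n₂, ENNReal.ofReal_mul n₁, ENNReal.ofReal_mul n₂]
    ring
  -- Passage from `P`-almost all `ω` to `μ`-almost all `x`: the identity can fail only where the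
  -- marginal density vanishes, and there all four fiber integrals are zero.
  have hN : MeasurableSet {x | ψ₁₁ x * ψ₂₂ x = ψ₁₂ x * ψ₂₁ x}ᶜ :=
    (measurableSet_eq_fun (m₁₁.mul m₂₂) (m₁₂.mul m₂₁)).compl
  have h0 : ∫⁻ x, ({x | ψ₁₁ x * ψ₂₂ x = ψ₁₂ x * ψ₂₁ x}ᶜ).indicator 1 x
      * fiberIntegral e ν q univ x ∂μ = 0 := by
    rw [setLIntegral_fiberIntegral e he hq .univ (measurable_one.indicator hN), ← hP,
      setLIntegral_univ, lintegral_eq_zero_iff' (by fun_prop (disch := assumption))]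
    filter_upwards [hae] with ω hω
    simp [hω]
  replace h0 := (lintegral_eq_zero_iff ((measurable_one.indicator hN).mul
    (measurable_fiberIntegral e hq .univ))).1 h0
  filter_upwards [h0, h₁₁, h₂₂, h₁₂, h₂₁] with x h0 h₁₁ h₂₂ h₁₂ h₂₁
  rw [h₁₁, h₂₂, h₁₂, h₂₁]
  by_cases hx : ψ₁₁ x * ψ₂₂ x = ψ₁₂ x * ψ₂₁ x
  · rw [mul_mul_mul_comm, hx, mul_mul_mul_comm]
  · have : fiberIntegral e ν q univ x = 0 := by simpa [hx] using h0
    simp [this]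

end Fiber

/-! ### From fiber integrals to the pointwise cross-ratio identity of the density. -/

section FourPoint

variable {n : ℕ}

/-- The splitting of `ℝⁿ` into the coordinates other than `k`, `l` and the coordinates `k`, `l`. -/
noncomputable def splitCoords (k l : Fin n) :
    (Fin n → ℝ) ≃ᵐ ({m // m ∈ ({k, l}ᶜ : Finset (Fin n))} → ℝ) ×
      ({m // ¬ m ∈ ({k, l}ᶜ : Finset (Fin n))} → ℝ) :=
  MeasurableEquiv.piEquivPiSubtypeProd (fun _ => ℝ) fun m => m ∈ ({k, l}ᶜ : Finset (Fin n))

theorem splitCoords_symm_of_mem {k l m : Fin n} (hm : m ∈ ({k, l}ᶜ : Finset (Fin n))) (r y) :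
    (splitCoords k l).symm (r, y) m = r ⟨m, hm⟩ :=
  dif_pos hm

theorem splitCoords_symm_of_notMem {k l m : Fin n} (hm : ¬ m ∈ ({k, l}ᶜ : Finset (Fin n))) (r y) :
    (splitCoords k l).symm (r, y) m = y ⟨m, hm⟩ :=
  dif_neg hm

theorem measurePreserving_splitCoords (k l : Fin n) :
    MeasurePreserving (splitCoords k l) volume (volume.prod volume) := by
  convert volume_preserving_piEquivPiSubtypeProd (fun _ : Fin n => ℝ) fun m =>
    m ∈ ({k, l}ᶜ : Finset (Fin n))
  · rfl
  · rfl
  · rw [Measure.volume_eq_prod]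
    congr!

/-- In the sup metric a square in the coordinates `k`, `l` is a ball of the fiber, so its volume
depends only on `δ`. -/
theorem splitCoords_symm_mem_iff {k l : Fin n} {c : Fin n → ℝ} {δ : ℝ} (hδ : 0 < δ) (r y) :
    (splitCoords k l).symm (r, y) ∈ (fun z : Fin n → ℝ => z k) ⁻¹' Metric.ball (c k) δ ∩
        (fun z : Fin n → ℝ => z l) ⁻¹' Metric.ball (c l) δ ↔
      y ∈ Metric.ball (splitCoords k l c).2 δ := by
  have hk : ¬ k ∈ ({k, l}ᶜ : Finset (Fin n)) := by simp
  have hl : ¬ l ∈ ({k, l}ᶜ : Finset (Fin n)) := by simp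
  rw [mem_inter_iff, mem_preimage, mem_preimage, splitCoords_symm_of_notMem hk,
    splitCoords_symm_of_notMem hl, Metric.mem_ball (x := (splitCoords k l c).2), dist_pi_lt_iff hδ]
  constructor
  · rintro ⟨h1, h2⟩ ⟨m, hm⟩
    have hm' : m = k ∨ m = l := by simpa [or_iff_not_imp_left] using hm
    rcases hm' with rfl | rfl
    · exact h1
    · exact h2
  · exact fun h => ⟨h ⟨k, hk⟩, h ⟨l, hl⟩⟩

theorem splitCoords_symm_mem_ball {k l : Fin n} {c : Fin n → ℝ} {δ : ℝ} (hδ : 0 < δ) {r y}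
    (hr : r ∈ Metric.ball (splitCoords k l c).1 δ) (hy : y ∈ Metric.ball (splitCoords k l c).2 δ) :
    (splitCoords k l).symm (r, y) ∈ Metric.ball c δ := by
  rw [Metric.mem_ball, dist_pi_lt_iff hδ] at *
  intro m
  by_cases hm : m ∈ ({k, l}ᶜ : Finset (Fin n))
  · rw [splitCoords_symm_of_mem hm]
    exact hr ⟨m, hm⟩
  · rw [splitCoords_symm_of_notMem hm]
    exact hy ⟨m, hm⟩

theorem le_fiberIntegral_box {k l : Fin n} {p : (Fin n → ℝ) → ℝ} {c : Fin n → ℝ} {δ a : ℝ}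
    (hδ : 0 < δ) (ha : ∀ z ∈ Metric.ball c δ, a ≤ p z) {r}
    (hr : r ∈ Metric.ball (splitCoords k l c).1 δ) :
    ENNReal.ofReal a * volume (Metric.ball (splitCoords k l c).2 δ) ≤
      fiberIntegral (splitCoords k l) volume (fun z => ENNReal.ofReal (p z))
        ((fun z : Fin n → ℝ => z k) ⁻¹' Metric.ball (c k) δ ∩
          (fun z : Fin n → ℝ => z l) ⁻¹' Metric.ball (c l) δ) r := by
  rw [← setLIntegral_const, ← lintegral_indicator Metric.isOpen_ball.measurableSet]
  refine lintegral_mono fun y => ?_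
  refine indicator_apply_le (g := fun y => indicator _ _ ((splitCoords k l).symm (r, y)))
    fun hy => ?_
  rw [indicator_of_mem ((splitCoords_symm_mem_iff hδ _ _).2 hy)]
  exact ENNReal.ofReal_le_ofReal (ha _ (splitCoords_symm_mem_ball hδ hr hy))

theorem fiberIntegral_box_le {k l : Fin n} {p : (Fin n → ℝ) → ℝ} {c : Fin n → ℝ} {δ a : ℝ}
    (hδ : 0 < δ) (ha : ∀ z ∈ Metric.ball c δ, p z ≤ a) {r}
    (hr : r ∈ Metric.ball (splitCoords k l c).1 δ) :
    fiberIntegral (splitCoords k l) volume (fun z => ENNReal.ofReal (p z))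
        ((fun z : Fin n → ℝ => z k) ⁻¹' Metric.ball (c k) δ ∩
          (fun z : Fin n → ℝ => z l) ⁻¹' Metric.ball (c l) δ) r ≤
      ENNReal.ofReal a * volume (Metric.ball (splitCoords k l c).2 δ) := by
  rw [← setLIntegral_const, ← lintegral_indicator Metric.isOpen_ball.measurableSet]
  refine lintegral_mono fun y => ?_
  by_cases hy : y ∈ Metric.ball (splitCoords k l c).2 δ
  · rw [indicator_of_mem hy]
    exact (indicator_le_self' (fun _ _ => zero_le) _).trans
      (ENNReal.ofReal_le_ofReal (ha _ (splitCoords_symm_mem_ball hδ hr hy)))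
  · rw [indicator_of_notMem (fun h => hy ((splitCoords_symm_mem_iff hδ _ _).1 h))]
    exact zero_le

theorem splitCoords_update_update_fst (k l : Fin n) (x : Fin n → ℝ) (a b : ℝ) :
    (splitCoords k l (update (update x k a) l b)).1 = (splitCoords k l x).1 := by
  funext ⟨m, hm⟩
  have hm' : m ≠ k ∧ m ≠ l := by simpa using hm
  change update (update x k a) l b m = x m
  simp [hm'.1, hm'.2]

variable {p : (Fin n → ℝ) → ℝ} {P : Measure (Fin n → ℝ)} [IsFiniteMeasure P] {k l : Fin n}

/-- If the strict opposite inequality held, it would persist with a margin `ε` on small boxes around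
the four corners, contradicting the cross-ratio identity for fiber integrals over these boxes. -/
theorem CondIndepGivenRest.density_mul_density_le (hp : Measurable p) (hp0 : ∀ z, 0 ≤ p z)
    (hP : P = volume.withDensity fun z => ENNReal.ofReal (p z)) (hkl : k ≠ l)
    (h : CondIndepGivenRest P k l) (x : Fin n → ℝ) (s₁ s₂ t₁ t₂ : ℝ)
    (h₁₁ : ContinuousAt p (update (update x k s₁) l t₁))
    (h₂₂ : ContinuousAt p (update (update x k s₂) l t₂))
    (h₁₂ : ContinuousAt p (update (update x k s₁) l t₂))
    (h₂₁ : ContinuousAt p (update (update x k s₂) l t₁)) :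
    p (update (update x k s₁) l t₁) * p (update (update x k s₂) l t₂) ≤
      p (update (update x k s₁) l t₂) * p (update (update x k s₂) l t₁) := by
  by_contra! hlt
  set c₁₁ := update (update x k s₁) l t₁ with hc₁₁
  set c₂₂ := update (update x k s₂) l t₂ with hc₂₂
  set c₁₂ := update (update x k s₁) l t₂ with hc₁₂
  set c₂₁ := update (update x k s₂) l t₁ with hc₂₁
  have hpos : 0 < p c₁₁ * p c₂₂ := (mul_nonneg (hp0 _) (hp0 _)).trans_lt hlt
  have hpos₁ : 0 < p c₁₁ := (hp0 _).lt_of_ne fun h => by simp [← h] at hpos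
  have hpos₂ : 0 < p c₂₂ := (hp0 _).lt_of_ne fun h => by simp [← h] at hpos
  obtain ⟨ε, hε, hε₁, hε₂, hεlt⟩ : ∃ ε > 0, ε < p c₁₁ ∧ ε < p c₂₂ ∧
      (p c₁₂ + ε) * (p c₂₁ + ε) < (p c₁₁ - ε) * (p c₂₂ - ε) := by
    have hL : Continuous fun ε : ℝ => (p c₁₂ + ε) * (p c₂₁ + ε) := by fun_prop
    have hR : Continuous fun ε : ℝ => (p c₁₁ - ε) * (p c₂₂ - ε) := by fun_prop
    have hev : ∀ᶠ ε in nhds (0 : ℝ), (p c₁₂ + ε) * (p c₂₁ + ε) < (p c₁₁ - ε) * (p c₂₂ - ε) :=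
      hL.continuousAt.eventually_lt hR.continuousAt (by simpa using hlt)
    obtain ⟨ε, ⟨⟨h1, h2⟩, h3⟩, h4⟩ := ((((hev.and (eventually_lt_nhds hpos₁)).and
      (eventually_lt_nhds hpos₂)).filter_mono nhdsWithin_le_nhds).and
      (self_mem_nhdsWithin (s := Ioi (0 : ℝ)))).exists
    exact ⟨ε, h4, h2, h3, h1⟩
  have near : ∀ c, ContinuousAt p c → ∀ᶠ δ in nhdsWithin (0 : ℝ) (Ioi 0),
      ∀ z ∈ Metric.ball c δ, p c - ε ≤ p z ∧ p z ≤ p c + ε := by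
    intro c hc
    obtain ⟨δ, hδ, H⟩ := Metric.continuousAt_iff.1 hc ε hε
    filter_upwards [Ioo_mem_nhdsGT hδ] with δ' hδ' z hz
    have := abs_lt.1 (H (lt_trans hz hδ'.2))
    constructor <;> linarith
  obtain ⟨δ, ⟨⟨⟨⟨n₁₁, n₂₂⟩, n₁₂⟩, n₂₁⟩, hδ⟩⟩ := (((((near _ h₁₁).and (near _ h₂₂)).and
    (near _ h₁₂)).and (near _ h₂₁)).and (self_mem_nhdsWithin (s := Ioi (0 : ℝ)))).exists
  replace hδ : 0 < δ := hδ
  have hae := fiberIntegral_mul_fiberIntegral_of_condIndepFun (splitCoords k l)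
    (measurePreserving_splitCoords k l) hp.ennreal_ofReal hP (coordAlgebra_le {k, l}ᶜ)
    (measurable_pi_apply k) (measurable_pi_apply l) h
    (s₁ := Metric.ball s₁ δ) (s₂ := Metric.ball s₂ δ) (t₁ := Metric.ball t₁ δ)
    (t₂ := Metric.ball t₂ δ) measurableSet_ball measurableSet_ball measurableSet_ball
    measurableSet_ball
  -- The identity holds for almost every `r`, hence for some `r` in a ball, which has positive
  -- volume.
  obtain ⟨r, hr, hrball⟩ : ∃ r, (_ = _) ∧ r ∈ Metric.ball (splitCoords k l x).1 δ := by
    by_contra! hno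
    exact (Metric.measure_ball_pos volume _ hδ).ne'
      (measure_mono_null (fun r hr hr' => hno r hr' hr) hae)
  have lo : ∀ s t, (∀ z ∈ Metric.ball (update (update x k s) l t) δ,
        p (update (update x k s) l t) - ε ≤ p z ∧ p z ≤ p (update (update x k s) l t) + ε) →
      ENNReal.ofReal (p (update (update x k s) l t) - ε) *
        ENNReal.ofReal ((2 * δ) ^ Fintype.card {m // ¬ m ∈ ({k, l}ᶜ : Finset (Fin n))}) ≤
      fiberIntegral (splitCoords k l) volume (fun z => ENNReal.ofReal (p z))
        ((fun z : Fin n → ℝ => z k) ⁻¹' Metric.ball s δ ∩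
          (fun z : Fin n → ℝ => z l) ⁻¹' Metric.ball t δ) r ∧
      fiberIntegral (splitCoords k l) volume (fun z => ENNReal.ofReal (p z))
        ((fun z : Fin n → ℝ => z k) ⁻¹' Metric.ball s δ ∩
          (fun z : Fin n → ℝ => z l) ⁻¹' Metric.ball t δ) r ≤
      ENNReal.ofReal (p (update (update x k s) l t) + ε) *
        ENNReal.ofReal ((2 * δ) ^ Fintype.card {m // ¬ m ∈ ({k, l}ᶜ : Finset (Fin n))}) := by
    intro s t hst
    have hr' : r ∈ Metric.ball (splitCoords k l (update (update x k s) l t)).1 δ := by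
      rwa [splitCoords_update_update_fst]
    have h1 := le_fiberIntegral_box hδ (fun z hz => (hst z hz).1) hr'
    have h2 := fiberIntegral_box_le hδ (fun z hz => (hst z hz).2) hr'
    rw [Real.volume_pi_ball _ hδ] at h1 h2
    simp only [update_self, update_of_ne hkl] at h1 h2
    exact ⟨h1, h2⟩
  have hV : 0 < (2 * δ) ^ Fintype.card {m // ¬ m ∈ ({k, l}ᶜ : Finset (Fin n))} := by positivity
  set V := (2 * δ) ^ Fintype.card {m // ¬ m ∈ ({k, l}ᶜ : Finset (Fin n))}
  -- All four boxes have the same fiber volume `V`, so a common factor `V * V` cancels.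
  have hfin := (mul_le_mul' (lo s₁ t₁ n₁₁).1 (lo s₂ t₂ n₂₂).1).trans
    (hr.le.trans (mul_le_mul' (lo s₁ t₂ n₁₂).2 (lo s₂ t₁ n₂₁).2))
  have q₁ := hp0 c₁₂
  have q₂ := hp0 c₂₁
  rw [← ENNReal.ofReal_mul (sub_pos.2 hε₁).le, ← ENNReal.ofReal_mul (sub_pos.2 hε₂).le,
    ← ENNReal.ofReal_mul (add_nonneg q₁ hε.le), ← ENNReal.ofReal_mul (add_nonneg q₂ hε.le),
    ← ENNReal.ofReal_mul (mul_nonneg (sub_pos.2 hε₁).le hV.le),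
    ← ENNReal.ofReal_mul (mul_nonneg (add_nonneg q₁ hε.le) hV.le),
    ENNReal.ofReal_le_ofReal_iff (by have := hε.le; positivity)] at hfin
  refine (mul_lt_mul_of_pos_right hεlt (mul_pos hV hV)).not_ge ?_
  rw [mul_mul_mul_comm, mul_mul_mul_comm (p c₁₂ + ε)]
  exact hfin

/-- The cross-ratio identity for the density of a law under which two coordinates are conditionally
independent given the others. -/
theorem CondIndepGivenRest.density_mul_density (hp : Measurable p) (hp0 : ∀ z, 0 ≤ p z)
    (hP : P = volume.withDensity fun z => ENNReal.ofReal (p z)) (hkl : k ≠ l)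
    (h : CondIndepGivenRest P k l) (x : Fin n → ℝ) (s₁ s₂ t₁ t₂ : ℝ)
    (h₁₁ : ContinuousAt p (update (update x k s₁) l t₁))
    (h₂₂ : ContinuousAt p (update (update x k s₂) l t₂))
    (h₁₂ : ContinuousAt p (update (update x k s₁) l t₂))
    (h₂₁ : ContinuousAt p (update (update x k s₂) l t₁)) :
    p (update (update x k s₁) l t₁) * p (update (update x k s₂) l t₂) =
      p (update (update x k s₁) l t₂) * p (update (update x k s₂) l t₁) :=
  -- The reverse inequality is the same one with `t₁` and `t₂` interchanged.
  le_antisymm (h.density_mul_density_le hp hp0 hP hkl x s₁ s₂ t₁ t₂ h₁₁ h₂₂ h₁₂ h₂₁)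
    (h.density_mul_density_le hp hp0 hP hkl x s₁ s₂ t₂ t₁ h₁₂ h₂₁ h₁₁ h₂₂)

end FourPoint

/-! ### Mixed partial derivatives and the second-order chain rule. -/

section PartialDerivatives

open scoped Topology

variable {n : ℕ}

theorem _root_.Filter.EventuallyEq.pderiv_eq {F G : (Fin n → ℝ) → ℝ} {x : Fin n → ℝ}
    (h : F =ᶠ[𝓝 x] G) (k : Fin n) : pderiv k F x = pderiv k G x := by
  rw [pderiv, pderiv, h.fderiv_eq]

theorem hasDerivAt_comp_update {F : (Fin n → ℝ) → ℝ} {x : Fin n → ℝ} {k : Fin n} {s : ℝ}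
    (hF : DifferentiableAt ℝ F (update x k s)) :
    HasDerivAt (fun s => F (update x k s)) (pderiv k F (update x k s)) s :=
  hF.hasFDerivAt.comp_hasDerivAt s (hasDerivAt_update x k s)

theorem contDiffAt_pderiv {F : (Fin n → ℝ) → ℝ} {x : Fin n → ℝ} (hF : ContDiffAt ℝ 2 F x)
    (k : Fin n) : ContDiffAt ℝ 1 (pderiv k F) x :=
  (hF.fderiv_right (m := 1) (by norm_num)).clm_apply contDiffAt_const

/-- A `C²` function whose mixed second differences in the directions `k`, `l` vanish has vanishing
mixed second derivative. -/
theorem pderiv_pderiv_eq_zero {F : (Fin n → ℝ) → ℝ} {W : Set (Fin n → ℝ)} (hW : IsOpen W)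
    (hF : ∀ x ∈ W, ContDiffAt ℝ 2 F x) {k l : Fin n} (hkl : k ≠ l)
    (H : ∀ x s₁ s₂ t₁ t₂, update (update x k s₁) l t₁ ∈ W → update (update x k s₂) l t₂ ∈ W →
      update (update x k s₁) l t₂ ∈ W → update (update x k s₂) l t₁ ∈ W →
      F (update (update x k s₁) l t₁) + F (update (update x k s₂) l t₂) =
        F (update (update x k s₁) l t₂) + F (update (update x k s₂) l t₁))
    {x : Fin n → ℝ} (hx : x ∈ W) : pderiv k (pderiv l F) x = 0 := by
  have hself : ∀ s, update (update x k s) l (x l) = update x k s := fun s => by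
    conv_lhs => rw [← update_of_ne hkl.symm s x]
    exact update_eq_self ..
  have hcont : Continuous fun st : ℝ × ℝ => update (update x k st.1) l st.2 :=
    ((continuous_const (y := x)).update k continuous_fst).update l continuous_snd
  have hev : ∀ᶠ st in 𝓝 (x k) ×ˢ 𝓝 (x l), update (update x k st.1) l st.2 ∈ W := by
    rw [← nhds_prod_eq]
    refine hcont.continuousAt.eventually_mem (hW.mem_nhds ?_)
    simpa [hself] using hx
  -- For `s` near `x k`, the slices of `F` in direction `l` through `s` and through `x k` differ
  -- locally by a constant, so `∂F/∂x_l` is locally constant in the coordinate `k`.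
  have hconst : (fun s => pderiv l F (update x k s)) =ᶠ[𝓝 (x k)] fun _ => pderiv l F x := by
    filter_upwards [hev.curry] with s hs
    have h1 := hasDerivAt_comp_update (F := F) (x := update x k s) (k := l) (s := x l)
      ((hF _ hs.self_of_nhds).differentiableAt (by norm_num))
    have h2 := hasDerivAt_comp_update (F := F) (x := update x k (x k)) (k := l) (s := x l)
      ((hF _ hev.curry.self_of_nhds.self_of_nhds).differentiableAt (by norm_num))
    have h3 : (fun t => F (update (update x k s) l t)) =ᶠ[𝓝 (x l)]
        fun t => F (update (update x k (x k)) l t) +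
          (F (update (update x k s) l (x l)) - F (update (update x k (x k)) l (x l))) := by
      filter_upwards [hs, hev.curry.self_of_nhds] with t ht ht'
      have := H x s (x k) t (x l) ht hev.curry.self_of_nhds.self_of_nhds hs.self_of_nhds ht'
      linarith
    have h4 := h1.unique ((h2.add_const _).congr_of_eventuallyEq h3)
    simpa [hself] using h4
  have h5 := hasDerivAt_comp_update (F := pderiv l F) (x := x) (k := k) (s := x k)
    ((contDiffAt_pderiv (by simpa using hF x hx) l).differentiableAt one_ne_zero)
  simpa using h5.unique ((hasDerivAt_const (x k) _).congr_of_eventuallyEq hconst)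

theorem pderiv_comp {L : (Fin n → ℝ) → ℝ} {v : (Fin n → ℝ) → Fin n → ℝ} {x : Fin n → ℝ}
    (hL : DifferentiableAt ℝ L (v x)) (hv : DifferentiableAt ℝ v x) (k : Fin n) :
    pderiv k (fun y => L (v y)) x = ∑ j, pderiv j L (v x) * pderiv k (fun y => v y j) x := by
  have h1 : pderiv k (fun y => L (v y)) x = fderiv ℝ L (v x) (fderiv ℝ v x (Pi.single k 1)) := by
    rw [pderiv, show (fun y => L (v y)) = L ∘ v from rfl, fderiv_comp x hL hv]
    rfl
  have h2 : ∀ j, pderiv k (fun y => v y j) x = fderiv ℝ v x (Pi.single k 1) j := fun j => by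
    rw [pderiv, fderiv_apply hv]
    rfl
  rw [h1]
  conv_lhs => rw [pi_eq_sum_univ' (fderiv ℝ v x (Pi.single k 1)), map_sum]
  refine Finset.sum_congr rfl fun j _ => ?_
  rw [map_smul, h2, smul_eq_mul, mul_comm]
  rfl

theorem pderiv_pderiv_comp {L : (Fin n → ℝ) → ℝ} {v : (Fin n → ℝ) → Fin n → ℝ} {x : Fin n → ℝ}
    (hL : ContDiff ℝ 2 L) (hv : ContDiffAt ℝ 2 v x) (k l : Fin n) :
    pderiv k (pderiv l fun y => L (v y)) x =
      ∑ j, ((∑ i, pderiv i (pderiv j L) (v x) * pderiv k (fun y => v y i) x) *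
          pderiv l (fun y => v y j) x +
        pderiv j L (v x) * pderiv k (pderiv l fun y => v y j) x) := by
  have h1 : (pderiv l fun y => L (v y)) =ᶠ[𝓝 x]
      fun y => ∑ j, pderiv j L (v y) * pderiv l (fun y => v y j) y := by
    filter_upwards [hv.eventually (by simp)] with y hy
    exact pderiv_comp (hL.contDiffAt.differentiableAt (by norm_num))
      (hy.differentiableAt (by norm_num)) l
  have hvd : DifferentiableAt ℝ v x := hv.differentiableAt (by norm_num)
  have hLd : ∀ j, DifferentiableAt ℝ (pderiv j L) (v x) := fun j =>
    (contDiffAt_pderiv hL.contDiffAt j).differentiableAt one_ne_zero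
  have hA : ∀ j, DifferentiableAt ℝ (fun y => pderiv j L (v y)) x := fun j =>
    (hLd j).comp x hvd
  have hB : ∀ j, DifferentiableAt ℝ (pderiv l fun y => v y j) x := fun j =>
    (contDiffAt_pderiv (contDiffAt_pi.1 hv j) l).differentiableAt one_ne_zero
  rw [h1.pderiv_eq, pderiv, fderiv_fun_sum fun j _ => (hA j).fun_mul (hB j),
    sum_apply]
  refine Finset.sum_congr rfl fun j _ => ?_
  rw [fderiv_fun_mul (hA j) (hB j), ← pderiv_comp (hLd j) hvd k]
  simp only [add_apply, smul_apply, smul_eq_mul]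
  rw [add_comm, mul_comm (pderiv l _ x)]
  rfl

theorem pderiv_comm {F : (Fin n → ℝ) → ℝ} {x : Fin n → ℝ} (hF : ContDiffAt ℝ 2 F x) (k l : Fin n) :
    pderiv k (pderiv l F) x = pderiv l (pderiv k F) x := by
  have hd : DifferentiableAt ℝ (fderiv ℝ F) x :=
    (hF.fderiv_right (m := 1) (by norm_num)).differentiableAt one_ne_zero
  have h : ∀ k l, pderiv k (pderiv l F) x
      = fderiv ℝ (fderiv ℝ F) x (Pi.single k 1) (Pi.single l 1) := fun k l => by
    rw [pderiv, show pderiv l F = fun y => fderiv ℝ F y (Pi.single l 1) from rfl,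
      fderiv_clm_apply hd (differentiableAt_const _)]
    simp
  rw [h, h]
  exact hF.isSymmSndFDerivAt (by simp) _ _

/-- A function that is differentiable along a coordinate segment and takes different values at its
ends has a nonzero partial derivative somewhere on the segment. -/
theorem exists_pderiv_ne_zero {F : (Fin n → ℝ) → ℝ} {x : Fin n → ℝ} {k : Fin n} {t : ℝ}
    (hF : ∀ y ∈ segment ℝ x (update x k t), DifferentiableAt ℝ F y)
    (hne : F (update x k t) ≠ F x) : ∃ y ∈ segment ℝ x (update x k t), pderiv k F y ≠ 0 := by
  by_contra! h0
  refine hne ?_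
  have hmem : ∀ s ∈ segment ℝ (x k) t, update x k s ∈ segment ℝ x (update x k t) := by
    intro s hs
    have h := mem_image_of_mem (update x k) hs
    rwa [Pi.image_update_segment, update_eq_self] at h
  have h := (convex_segment (x k) t).norm_image_sub_le_of_norm_hasDerivWithin_le (C := 0)
    (f := fun s => F (update x k s)) (f' := fun s => pderiv k F (update x k s))
    (fun s hs => (hasDerivAt_comp_update (hF _ (hmem s hs))).hasDerivWithinAt)
    (fun s hs => by rw [h0 _ (hmem s hs), norm_zero])
    (left_mem_segment ℝ (x k) t) (right_mem_segment ℝ (x k) t)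
  rw [zero_mul, norm_le_zero_iff, sub_eq_zero, update_eq_self] at h
  exact h

end PartialDerivatives

/-! ### Regularity of maps through immersions and the inverse function theorem. -/

section Immersion

open scoped Topology

/-- If `g` is a `C²` immersion and embedding, and `g ∘ h` is `C²`, then `h` is `C²`. -/
theorem contDiff_of_comp_embedding {E F G : Type*} [NormedAddCommGroup E] [NormedSpace ℝ E]
    [FiniteDimensional ℝ E] [NormedAddCommGroup F] [NormedSpace ℝ F] [FiniteDimensional ℝ F]
    [NormedAddCommGroup G] [NormedSpace ℝ G] {g : E → F} (hg : ContDiff ℝ 2 g)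
    (himm : ∀ z, Injective (fderiv ℝ g z)) (hemb : Topology.IsEmbedding g) {h : G → E}
    (hgh : ContDiff ℝ 2 fun z => g (h z)) : ContDiff ℝ 2 h := by
  have : CompleteSpace E := FiniteDimensional.complete ℝ E
  have hh : Continuous h := hemb.isInducing.continuous_iff.2 hgh.continuous
  refine contDiff_iff_contDiffAt.2 fun z => ?_
  -- With `A` a left inverse of the derivative, `A ∘ g` has derivative the identity at `h z`; near
  -- `z`, `h` is its local inverse applied to the `C²` map `A ∘ g ∘ h`.
  obtain ⟨A, hA⟩ := (fderiv ℝ g (h z) : E →ₗ[ℝ] F).exists_leftInverse_of_injective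
    (LinearMap.ker_eq_bot.2 (himm (h z)))
  have hAg : ContDiff ℝ 2 fun y => A.toContinuousLinearMap (g y) :=
    A.toContinuousLinearMap.contDiff.comp hg
  have hd : HasFDerivAt (fun y => A.toContinuousLinearMap (g y))
      ((ContinuousLinearEquiv.refl ℝ E : E ≃L[ℝ] E) : E →L[ℝ] E) (h z) := by
    have hc := A.toContinuousLinearMap.hasFDerivAt.comp (h z)
      (hg.differentiable (by norm_num) (h z)).hasFDerivAt
    rwa [show A.toContinuousLinearMap.comp (fderiv ℝ g (h z)) =
      ((ContinuousLinearEquiv.refl ℝ E : E ≃L[ℝ] E) : E →L[ℝ] E) from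
      ContinuousLinearMap.ext fun w => LinearMap.congr_fun hA w] at hc
  have hl := hAg.contDiffAt.to_localInverse (n := 2) hd (by norm_num)
  refine (hl.comp z (f := fun z => A.toContinuousLinearMap (g (h z)))
    (A.toContinuousLinearMap.contDiff.comp hgh).contDiffAt).congr_of_eventuallyEq ?_
  have hs := (hAg.contDiffAt (x := h z)).hasStrictFDerivAt' hd (by norm_num)
  filter_upwards [hh.continuousAt.eventually hs.eventually_left_inverse] with y hy
  exact hy.symm

variable {E : Type*} [NormedAddCommGroup E] [NormedSpace ℝ E] [FiniteDimensional ℝ E]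
  {h v : E → E}

theorem exists_equiv_hasFDerivAt (hh : ContDiff ℝ 2 h) {z : E}
    (hinj : Injective (fderiv ℝ h z)) :
    ∃ e : E ≃L[ℝ] E, HasFDerivAt h (e : E →L[ℝ] E) z := by
  refine ⟨(LinearEquiv.ofInjectiveEndo (fderiv ℝ h z : E →ₗ[ℝ] E) hinj).toContinuousLinearEquiv, ?_⟩
  convert (hh.differentiable (by norm_num) z).hasFDerivAt using 1
  ext
  rfl

theorem isOpen_range_of_injective_fderiv (hh : ContDiff ℝ 2 h)
    (hinj : ∀ z, Injective (fderiv ℝ h z)) : IsOpen (range h) := by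
  have : CompleteSpace E := FiniteDimensional.complete ℝ E
  choose e he using fun z => exists_equiv_hasFDerivAt hh (hinj z)
  exact (isOpenMap_of_hasStrictFDerivAt_equiv fun z =>
    hh.contDiffAt.hasStrictFDerivAt' (he z) (by norm_num)).isOpen_range

theorem contDiffAt_of_leftInverse (hh : ContDiff ℝ 2 h) (hv : LeftInverse v h) {z : E}
    (hinj : Injective (fderiv ℝ h z)) : ContDiffAt ℝ 2 v (h z) := by
  have : CompleteSpace E := FiniteDimensional.complete ℝ E
  obtain ⟨e, he⟩ := exists_equiv_hasFDerivAt hh hinj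
  refine (hh.contDiffAt.to_localInverse (n := 2) he (by norm_num)).congr_of_eventuallyEq ?_
  have hs := (hh.contDiffAt (x := z)).hasStrictFDerivAt' he (by norm_num)
  filter_upwards [hs.eventually_right_inverse] with y hy
  exact (congrArg v hy).symm.trans (hv _)

end Immersion

/-! ### Positivity and continuity of the volume factor. -/

section VolFactor

variable {n d : ℕ} {g : (Fin n → ℝ) → (Fin d → ℝ)}

theorem volFactor_pos {z : Fin n → ℝ} (h : Injective (fderiv ℝ g z)) : 0 < volFactor g z := by
  refine Real.sqrt_pos.2 ?_
  rw [← Matrix.conjTranspose_eq_transpose_of_trivial]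
  refine (Matrix.PosDef.conjTranspose_mul_self _ fun x y hxy => h ?_).det_pos
  rw [LinearMap.toMatrix'_mulVec, LinearMap.toMatrix'_mulVec] at hxy
  exact hxy

theorem continuous_volFactor (h : ContDiff ℝ 2 g) : Continuous (volFactor g) := by
  have hJ : Continuous fun z =>
      LinearMap.toMatrix' (fderiv ℝ g z : (Fin n → ℝ) →ₗ[ℝ] (Fin d → ℝ)) := by
    refine continuous_matrix fun i j => ?_
    simp only [LinearMap.toMatrix'_apply]
    exact (continuous_apply i).comp ((h.continuous_fderiv (by norm_num)).clm_apply continuous_const)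
  exact Real.continuous_sqrt.comp (hJ.matrix_transpose.matrix_mul hJ).matrix_det

end VolFactor

/-! ### The change of latent variables, its Jacobian and the transformation of densities. -/

namespace Model

variable {ι : Type*} {n d : ℕ} {M M' : Model ι n d}

theorem obsDensity_apply_g (M : Model ι n d) (u : ι) (z : Fin n → ℝ) :
    M.obsDensity u (M.g z) = M.p u z / volFactor M.g z := by
  rw [obsDensity, if_pos (mem_range_self z), leftInverse_invFun M.g_embedding.injective z]

theorem obsDensity_of_notMem (M : Model ι n d) (u : ι) {x : Fin d → ℝ} (hx : x ∉ range M.g) :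
    M.obsDensity u x = 0 :=
  if_neg hx

/-- The observed density of `M` is positive on its image, while that of `M'` vanishes off its own.
-/
theorem SmoothPositive.range_subset [Nonempty ι] (hM : M.SmoothPositive) (h : M'.Matches M) :
    range M.g ⊆ range M'.g := by
  rintro _ ⟨z, rfl⟩
  by_contra hz
  obtain ⟨u⟩ := ‹Nonempty ι›
  have h1 := h u _ (mem_range_self z)
  rw [obsDensity_apply_g, obsDensity_of_notMem _ _ hz] at h1
  exact (div_pos ((hM u).2 z) (volFactor_pos (M.g_immersion z))).ne' h1

/-- The recovered latent variables as a function of the true ones. -/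
noncomputable def recoveredOfTrue (M M' : Model ι n d) (z : Fin n → ℝ) : Fin n → ℝ :=
  invFun M'.g (M.g z)

theorem g_recoveredOfTrue (hsub : range M.g ⊆ range M'.g) (z : Fin n → ℝ) :
    M'.g (M.recoveredOfTrue M' z) = M.g z :=
  invFun_eq (hsub (mem_range_self z))

theorem leftInverse_trueOfRecovered (hsub : range M.g ⊆ range M'.g) :
    LeftInverse (M.trueOfRecovered M') (M.recoveredOfTrue M') := fun z => by
  rw [trueOfRecovered, g_recoveredOfTrue hsub, leftInverse_invFun M.g_embedding.injective z]

theorem recoveredDomain_eq_range (hsub : range M.g ⊆ range M'.g) :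
    M.recoveredDomain M' = range (M.recoveredOfTrue M') := by
  ext y
  constructor
  · rintro ⟨z, hz⟩
    exact ⟨z, M'.g_embedding.injective (by rw [g_recoveredOfTrue hsub, hz])⟩
  · rintro ⟨z, rfl⟩
    exact ⟨z, (g_recoveredOfTrue hsub z).symm⟩

theorem contDiff_recoveredOfTrue (hsub : range M.g ⊆ range M'.g) :
    ContDiff ℝ 2 (M.recoveredOfTrue M') :=
  contDiff_of_comp_embedding M'.g_contDiff M'.g_immersion M'.g_embedding
    (by simpa only [g_recoveredOfTrue hsub] using M.g_contDiff)

theorem injective_fderiv_recoveredOfTrue (hsub : range M.g ⊆ range M'.g) (z : Fin n → ℝ) :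
    Injective (fderiv ℝ (M.recoveredOfTrue M') z) := by
  have hc := fderiv_comp z (g := M'.g) (f := M.recoveredOfTrue M')
    (M'.g_contDiff.differentiable (by norm_num) _)
    ((contDiff_recoveredOfTrue hsub).differentiable (by norm_num) _)
  rw [show M'.g ∘ M.recoveredOfTrue M' = M.g from funext (g_recoveredOfTrue hsub)] at hc
  have hi := M.g_immersion z
  rw [hc, ContinuousLinearMap.coe_comp] at hi
  exact hi.of_comp

theorem isOpen_recoveredDomain (hsub : range M.g ⊆ range M'.g) :
    IsOpen (M.recoveredDomain M') := by
  rw [recoveredDomain_eq_range hsub]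
  exact isOpen_range_of_injective_fderiv (contDiff_recoveredOfTrue hsub)
    (injective_fderiv_recoveredOfTrue hsub)

theorem isPreconnected_recoveredDomain (hsub : range M.g ⊆ range M'.g) :
    IsPreconnected (M.recoveredDomain M') := by
  rw [recoveredDomain_eq_range hsub]
  exact isPreconnected_range (contDiff_recoveredOfTrue hsub).continuous

theorem contDiffAt_trueOfRecovered (hsub : range M.g ⊆ range M'.g) {y : Fin n → ℝ}
    (hy : y ∈ M.recoveredDomain M') : ContDiffAt ℝ 2 (M.trueOfRecovered M') y := by
  rw [recoveredDomain_eq_range hsub] at hy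
  obtain ⟨z, rfl⟩ := hy
  exact contDiffAt_of_leftInverse (contDiff_recoveredOfTrue hsub) (leftInverse_trueOfRecovered hsub)
    (injective_fderiv_recoveredOfTrue hsub z)

/-- The partial derivative `∂Z_i/∂Ẑ_k`. -/
noncomputable def jac (M M' : Model ι n d) (y : Fin n → ℝ) (i k : Fin n) : ℝ :=
  pderiv k (fun y => M.trueOfRecovered M' y i) y

theorem continuousAt_jac (hsub : range M.g ⊆ range M'.g) {y : Fin n → ℝ}
    (hy : y ∈ M.recoveredDomain M') (i k : Fin n) : ContinuousAt (fun y => M.jac M' y i k) y :=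
  (contDiffAt_pderiv (contDiffAt_pi.1 (contDiffAt_trueOfRecovered hsub hy) i) k).continuousAt

/-- Differentiating `v ∘ h = id`, with `h` the map from true to recovered latents, exhibits the
determinant as a factor of `1`. -/
theorem det_jac_ne_zero (hsub : range M.g ⊆ range M'.g) {y : Fin n → ℝ}
    (hy : y ∈ M.recoveredDomain M') : (Matrix.of (M.jac M' y)).det ≠ 0 := by
  have hv := (contDiffAt_trueOfRecovered hsub hy).differentiableAt (by norm_num)
  have hJ : Matrix.of (M.jac M' y) = LinearMap.toMatrix'
      (fderiv ℝ (M.trueOfRecovered M') y : (Fin n → ℝ) →ₗ[ℝ] (Fin n → ℝ)) := by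
    ext i k
    rw [LinearMap.toMatrix'_apply, Matrix.of_apply, jac, pderiv, fderiv_apply hv]
    simp [Pi.single]
  rw [recoveredDomain_eq_range hsub] at hy
  obtain ⟨z, rfl⟩ := hy
  have hc := fderiv_comp z hv ((contDiff_recoveredOfTrue hsub).differentiable (by norm_num) _)
  rw [(leftInverse_trueOfRecovered hsub).comp_eq_id, fderiv_id] at hc
  have hm := congrArg (fun L : (Fin n → ℝ) →L[ℝ] (Fin n → ℝ) =>
    (LinearMap.toMatrix' (L : (Fin n → ℝ) →ₗ[ℝ] (Fin n → ℝ))).det) hc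
  simp only [ContinuousLinearMap.coe_id, ContinuousLinearMap.toLinearMap_comp,
    LinearMap.toMatrix'_comp, LinearMap.toMatrix'_id, Matrix.det_mul, Matrix.det_one] at hm
  rw [hJ]
  exact left_ne_zero_of_mul (hm ▸ one_ne_zero)

theorem p_eq_of_matches (hsub : range M.g ⊆ range M'.g) (h : M'.Matches M) (u : ι)
    {y : Fin n → ℝ} (hy : y ∈ M.recoveredDomain M') :
    M'.p u y = M.p u (M.trueOfRecovered M' y) *
      (volFactor M'.g y / volFactor M.g (M.trueOfRecovered M' y)) := by
  rw [recoveredDomain_eq_range hsub] at hy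
  obtain ⟨z, rfl⟩ := hy
  have h1 := h u _ (mem_range_self z)
  rw [obsDensity_apply_g, ← g_recoveredOfTrue hsub z, obsDensity_apply_g,
    eq_div_iff (volFactor_pos (M'.g_immersion _)).ne'] at h1
  rw [leftInverse_trueOfRecovered hsub z, ← h1]
  ring

theorem exists_jac_ne_zero (hsub : range M.g ⊆ range M'.g) {i k : Fin n}
    (h : M.IsFunctionOf M' i k) : ∃ y ∈ M.recoveredDomain M', M.jac M' y i k ≠ 0 := by
  obtain ⟨x, t, hseg, hne⟩ := h
  obtain ⟨y, hy, hy'⟩ := exists_pderiv_ne_zero (F := fun y => M.trueOfRecovered M' y i)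
    (fun y hy => (contDiffAt_pi.1 (contDiffAt_trueOfRecovered hsub (hseg hy)) i).differentiableAt
      (by norm_num)) hne
  exact ⟨y, hseg hy, hy'⟩

end Model

/-! ### Linear independence and quadratic sums supported on a graph. -/

section LinearAlgebra

/-- A linear functional that vanishes on as many linearly independent vectors as there are
coordinates is zero. -/
theorem eq_zero_of_forall_sum_mul_eq_zero {α β : Type*} [Fintype α] [Fintype β] {x : β → α → ℝ}
    (hx : LinearIndependent ℝ x) (hcard : Fintype.card α ≤ Fintype.card β) {c : α → ℝ}
    (hc : ∀ u, ∑ a, c a * x u a = 0) : c = 0 := by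
  classical
  have hspan : Submodule.span ℝ (range x) = ⊤ := by
    refine hx.span_eq_top_of_card_eq_finrank' (le_antisymm hx.fintype_card_le_finrank ?_)
    rwa [Module.finrank_fintype_fun_eq_card]
  have hφ : ∑ a, c a • LinearMap.proj (R := ℝ) (φ := fun _ : α => ℝ) a = 0 := by
    refine LinearMap.ext_on_range hspan fun u => ?_
    simpa using hc u
  funext a
  simpa [Pi.single_apply] using LinearMap.congr_fun hφ (Pi.single a 1)

theorem sum_sum_eq_sum_diag_add_sum_lt {n : ℕ} (f : Fin n → Fin n → ℝ) :
    ∑ j, ∑ i, f i j = ∑ i, f i i +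
      ∑ e : Fin n × Fin n, if e.1 < e.2 then f e.1 e.2 + f e.2 e.1 else 0 := by
  have h : ∀ i j, f i j = (if i = j then f i j else 0) + (if i < j then f i j else 0) +
      (if j < i then f i j else 0) := fun i j => by
    rcases lt_trichotomy i j with h | h | h
    · simp [h, h.ne, h.le.not_gt]
    · simp [h]
    · simp [h, h.ne', h.le.not_gt]
  have h' : ∀ e : Fin n × Fin n, (if e.1 < e.2 then f e.1 e.2 + f e.2 e.1 else 0) =
      (if e.1 < e.2 then f e.1 e.2 else 0) + (if e.1 < e.2 then f e.2 e.1 else 0) := fun e => by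
    split_ifs <;> simp
  simp_rw [h', Finset.sum_add_distrib, Fintype.sum_prod_type]
  conv_lhs => enter [2, j, 2, i]; rw [h i j]
  simp_rw [Finset.sum_add_distrib]
  rw [Finset.sum_comm (f := fun j i => if i < j then f i j else 0), add_assoc]
  simp

/-- A quadratic expression whose off-diagonal coefficients vanish off the edges of a graph. -/
theorem sum_sum_mul_eq_of_adj {n : ℕ} (G : SimpleGraph (Fin n))
    [Fintype {e : Fin n × Fin n // G.Adj e.1 e.2 ∧ e.1 < e.2}] {H : Fin n → Fin n → ℝ}
    (hsymm : ∀ i j, H i j = H j i) (hzero : ∀ i j, i ≠ j → ¬ G.Adj i j → H i j = 0)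
    (a b : Fin n → ℝ) :
    ∑ j, ∑ i, H i j * a i * b j = ∑ i, a i * b i * H i i +
      ∑ e : {e : Fin n × Fin n // G.Adj e.1 e.2 ∧ e.1 < e.2},
        (a e.1.1 * b e.1.2 + a e.1.2 * b e.1.1) * H e.1.1 e.1.2 := by
  classical
  rw [sum_sum_eq_sum_diag_add_sum_lt fun i j => H i j * a i * b j]
  congr 1
  · exact Finset.sum_congr rfl fun i _ => by ring
  rw [← Finset.sum_subtype (Finset.univ.filter fun e : Fin n × Fin n => G.Adj e.1 e.2 ∧ e.1 < e.2)
    (by simp) (fun e => (a e.1 * b e.2 + a e.2 * b e.1) * H e.1 e.2), Finset.sum_filter]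
  refine Finset.sum_congr rfl fun e _ => ?_
  by_cases hlt : e.1 < e.2
  · by_cases hadj : G.Adj e.1 e.2
    · rw [if_pos hlt, if_pos ⟨hadj, hlt⟩, hsymm e.2 e.1]
      ring
    · rw [if_pos hlt, if_neg fun h => hadj h.1, hsymm e.2 e.1, hzero _ _ hlt.ne hadj]
      ring
  · rw [if_neg hlt, if_neg fun h => hlt h.2]

theorem card_lt_adj_le_ncard_edgeSet {n : ℕ} (G : SimpleGraph (Fin n))
    [Fintype {e : Fin n × Fin n // G.Adj e.1 e.2 ∧ e.1 < e.2}] :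
    Fintype.card {e : Fin n × Fin n // G.Adj e.1 e.2 ∧ e.1 < e.2} ≤ G.edgeSet.ncard := by
  rw [← Nat.card_coe_set_eq, ← Nat.card_eq_fintype_card]
  refine Nat.card_le_card_of_injective
    (fun e => (⟨s(e.1.1, e.1.2), e.2.1⟩ : G.edgeSet)) fun e e' h => ?_
  have h' := Sym2.eq_iff.1 (congrArg Subtype.val h)
  rcases h' with ⟨h1, h2⟩ | ⟨h1, h2⟩
  · exact Subtype.ext (Prod.ext h1 h2)
  · have := e.2.2
    have := e'.2.2
    simp only [h1, h2] at *
    exact absurd ‹e'.1.2 < e'.1.1› (not_lt_of_gt ‹_›)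

end LinearAlgebra

/-! ### Pointwise relations between the entries of the Jacobian. -/

namespace Model

variable {ι : Type*} {n d : ℕ} {M M' : Model ι n d}

theorem condIndepGivenRest_of_not_adj {i j : Fin n} (hij : i ≠ j)
    (h : ¬ M.markovNetwork.Adj i j) (u : ι) : CondIndepGivenRest (M.law u) i j := by
  by_contra hu
  exact h ⟨hij, u, hu⟩

theorem SmoothPositive.contDiff_log (hM : M.SmoothPositive) (u : ι) :
    ContDiff ℝ 2 fun z => Real.log (M.p u z) :=
  (hM u).1.log fun z => ((hM u).2 z).ne'

/-- Along non-edges of the Markov network, the mixed second derivatives of the log-density vanish. -/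
theorem SmoothPositive.pderiv_pderiv_log_eq_zero (hM : M.SmoothPositive) {i j : Fin n}
    (hij : i ≠ j) (h : ¬ M.markovNetwork.Adj i j) (u : ι) (z : Fin n → ℝ) :
    pderiv i (pderiv j fun z => Real.log (M.p u z)) z = 0 := by
  refine pderiv_pderiv_eq_zero isOpen_univ (fun x _ => (hM.contDiff_log u).contDiffAt) hij
    (fun x s₁ s₂ t₁ t₂ _ _ _ _ => ?_) (mem_univ z)
  have hc : Continuous (M.p u) := (hM u).1.continuous
  have h4 := (condIndepGivenRest_of_not_adj hij h u).density_mul_density (M.p_measurable u)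
    (M.p_nonneg u) (M.p_density u) hij x s₁ s₂ t₁ t₂ hc.continuousAt hc.continuousAt
    hc.continuousAt hc.continuousAt
  have hne := fun z => ((hM u).2 z).ne'
  rw [← Real.log_mul (hne _) (hne _), h4, Real.log_mul (hne _) (hne _)]

theorem continuousAt_p_of_matches (hM : M.SmoothPositive) (hsub : range M.g ⊆ range M'.g)
    (h : M'.Matches M) (u : ι) {y : Fin n → ℝ} (hy : y ∈ M.recoveredDomain M') :
    ContinuousAt (M'.p u) y := by
  have hv := (contDiffAt_trueOfRecovered hsub hy).continuousAt
  have hc : ContinuousAt (fun y => M.p u (M.trueOfRecovered M' y) *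
      (volFactor M'.g y / volFactor M.g (M.trueOfRecovered M' y))) y :=
    ((hM u).1.continuous.continuousAt.comp hv).mul
      ((continuous_volFactor M'.g_contDiff).continuousAt.div
        ((continuous_volFactor M.g_contDiff).continuousAt.comp hv)
        (volFactor_pos (M.g_immersion _)).ne')
  refine hc.congr_of_eventuallyEq ?_
  filter_upwards [(isOpen_recoveredDomain hsub).mem_nhds hy] with y hy
  exact p_eq_of_matches hsub h u hy

/-- Along non-edges of the recovered Markov network, the mixed second derivatives of the
log-density ratios between domains vanish. -/
theorem pderiv_pderiv_log_sub_log_eq_zero (hM : M.SmoothPositive)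
    (hsub : range M.g ⊆ range M'.g) (h : M'.Matches M) {k l : Fin n} (hkl : k ≠ l)
    (hadj : ¬ M'.markovNetwork.Adj k l) (u u₀ : ι) {y : Fin n → ℝ}
    (hy : y ∈ M.recoveredDomain M') :
    pderiv k (pderiv l fun y => Real.log (M.p u (M.trueOfRecovered M' y)) -
      Real.log (M.p u₀ (M.trueOfRecovered M' y))) y = 0 := by
  refine pderiv_pderiv_eq_zero (isOpen_recoveredDomain hsub) (fun x hx => ?_) hkl
    (fun x s₁ s₂ t₁ t₂ h₁₁ h₂₂ h₁₂ h₂₁ => ?_) hy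
  -- The volume factors contain first derivatives of `C²` maps, so a single recovered log-density
  -- need not be `C²`. The difference between two domains involves only the true densities composed
  -- with `v`.
  · exact ((hM.contDiff_log u).contDiffAt.comp x (contDiffAt_trueOfRecovered hsub hx)).sub
      ((hM.contDiff_log u₀).contDiffAt.comp x (contDiffAt_trueOfRecovered hsub hx))
  · have key := fun u => (condIndepGivenRest_of_not_adj hkl hadj u).density_mul_density
      (M'.p_measurable u) (M'.p_nonneg u) (M'.p_density u) hkl x s₁ s₂ t₁ t₂
      (continuousAt_p_of_matches hM hsub h u h₁₁) (continuousAt_p_of_matches hM hsub h u h₂₂)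
      (continuousAt_p_of_matches hM hsub h u h₁₂) (continuousAt_p_of_matches hM hsub h u h₂₁)
    have hne := fun u z => ((hM u).2 z).ne'
    have hQ : ∀ y, volFactor M'.g y / volFactor M.g (M.trueOfRecovered M' y) ≠ 0 := fun y =>
      (div_pos (volFactor_pos (M'.g_immersion _)) (volFactor_pos (M.g_immersion _))).ne'
    have key' := fun u => congrArg Real.log (key u)
    simp only [p_eq_of_matches hsub h _ h₁₁, p_eq_of_matches hsub h _ h₂₂,
      p_eq_of_matches hsub h _ h₁₂, p_eq_of_matches hsub h _ h₂₁,
      Real.log_mul (mul_ne_zero (hne _ _) (hQ _)) (mul_ne_zero (hne _ _) (hQ _)),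
      Real.log_mul (hne _ _) (hQ _)] at key'
    -- The logarithms of the volume ratios are the same in both domains and cancel on subtraction.
    have e1 := key' u
    have e2 := key' u₀
    linarith

/-- The coefficients of the vector `w` in the mixed second derivative of a function of the true
latent variables along the recovered ones `k`, `l`. -/
noncomputable def mixedCoeff (M M' : Model ι n d) (k l : Fin n) (y : Fin n → ℝ) :
    Fin n ⊕ Fin n ⊕ {e : Fin n × Fin n // M.markovNetwork.Adj e.1 e.2 ∧ e.1 < e.2} → ℝ
  | .inl i => pderiv k (pderiv l fun y => M.trueOfRecovered M' y i) y
  | .inr (.inl i) => M.jac M' y i k * M.jac M' y i l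
  | .inr (.inr e) => M.jac M' y e.1.1 k * M.jac M' y e.1.2 l +
      M.jac M' y e.1.2 k * M.jac M' y e.1.1 l

theorem pderiv_pderiv_log_comp_eq_sum
    [Fintype {e : Fin n × Fin n // M.markovNetwork.Adj e.1 e.2 ∧ e.1 < e.2}]
    (hM : M.SmoothPositive) (hsub : range M.g ⊆ range M'.g)
    (k l : Fin n) (u : ι) {y : Fin n → ℝ} (hy : y ∈ M.recoveredDomain M') :
    pderiv k (pderiv l fun y => Real.log (M.p u (M.trueOfRecovered M' y))) y =
      ∑ a, M.mixedCoeff M' k l y a * M.w (M.trueOfRecovered M' y) u a := by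
  rw [pderiv_pderiv_comp (L := fun z => Real.log (M.p u z)) (hM.contDiff_log u)
    (contDiffAt_trueOfRecovered hsub hy) k l, Fintype.sum_sum_type, Fintype.sum_sum_type]
  have h := sum_sum_mul_eq_of_adj M.markovNetwork
    (H := fun i j => pderiv i (pderiv j fun z => Real.log (M.p u z)) (M.trueOfRecovered M' y))
    (fun i j => pderiv_comm (hM.contDiff_log u).contDiffAt i j)
    (fun i j hij hadj => hM.pderiv_pderiv_log_eq_zero hij hadj u _)
    (fun i => M.jac M' y i k) (fun i => M.jac M' y i l)
  simp only [mixedCoeff, w]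
  rw [← h, ← Finset.sum_add_distrib]
  refine Finset.sum_congr rfl fun j _ => ?_
  rw [Finset.sum_mul, add_comm, mul_comm (pderiv j _ _)]
  rfl

/-- The mixed coefficients vanish along non-edges of the recovered Markov network. -/
theorem mixedCoeff_eq_zero (hM : M.SmoothPositive) (hA2 : M.SufficientChanges)
    (hsub : range M.g ⊆ range M'.g) (h : M'.Matches M) {k l : Fin n} (hkl : k ≠ l)
    (hadj : ¬ M'.markovNetwork.Adj k l) {y : Fin n → ℝ} (hy : y ∈ M.recoveredDomain M') :
    M.mixedCoeff M' k l y = 0 := by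
  classical
  obtain ⟨θ, hθ⟩ := hA2 (M.trueOfRecovered M' y)
  have : Fintype {e : Fin n × Fin n // M.markovNetwork.Adj e.1 e.2 ∧ e.1 < e.2} :=
    Fintype.ofFinite _
  refine eq_zero_of_forall_sum_mul_eq_zero hθ ?_ fun u => ?_
  · have : _ ≤ M.numEdges := card_lt_adj_le_ncard_edgeSet M.markovNetwork
    simp only [Fintype.card_sum, Fintype.card_fin]
    lia
  · have hF : ∀ u, ∀ x ∈ M.recoveredDomain M',
        ContDiffAt ℝ 2 (fun y => Real.log (M.p u (M.trueOfRecovered M' y))) x := fun u x hx =>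
      (hM.contDiff_log u).contDiffAt.comp x (contDiffAt_trueOfRecovered hsub hx)
    have h0 := pderiv_pderiv_log_sub_log_eq_zero hM hsub h hkl hadj (θ u.succ) (θ 0) hy
    have h1 : (pderiv l fun y => Real.log (M.p (θ u.succ) (M.trueOfRecovered M' y)) -
        Real.log (M.p (θ 0) (M.trueOfRecovered M' y))) =ᶠ[nhds y]
        fun x => pderiv l (fun y => Real.log (M.p (θ u.succ) (M.trueOfRecovered M' y))) x -
          pderiv l (fun y => Real.log (M.p (θ 0) (M.trueOfRecovered M' y))) x := by
      filter_upwards [(isOpen_recoveredDomain hsub).mem_nhds hy] with x hx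
      rw [pderiv, fderiv_fun_sub ((hF _ x hx).differentiableAt (by norm_num))
        ((hF _ x hx).differentiableAt (by norm_num))]
      rfl
    rw [h1.pderiv_eq, pderiv, fderiv_fun_sub
      ((contDiffAt_pderiv (hF _ y hy) l).differentiableAt one_ne_zero)
      ((contDiffAt_pderiv (hF _ y hy) l).differentiableAt one_ne_zero), sub_apply] at h0
    have h2 := pderiv_pderiv_log_comp_eq_sum hM hsub k l (θ u.succ) hy
    have h3 := pderiv_pderiv_log_comp_eq_sum hM hsub k l (θ 0) hy
    simp only [Pi.sub_apply, mul_sub, Finset.sum_sub_distrib]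
    rw [← h2, ← h3]
    exact h0

theorem jac_mul_jac_eq_zero (hM : M.SmoothPositive) (hA2 : M.SufficientChanges)
    (hsub : range M.g ⊆ range M'.g) (h : M'.Matches M) {k l : Fin n} (hkl : k ≠ l)
    (hadj : ¬ M'.markovNetwork.Adj k l) {y : Fin n → ℝ} (hy : y ∈ M.recoveredDomain M')
    (i : Fin n) : M.jac M' y i k * M.jac M' y i l = 0 :=
  congrFun (mixedCoeff_eq_zero hM hA2 hsub h hkl hadj hy) (.inr (.inl i))

/-- The edge coefficient only gives a vanishing sum of two products. If the first product is
nonzero, the diagonal relation for `i` makes `∂Z_i/∂Ẑ_l` zero, which kills the second: a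
contradiction. -/
theorem jac_mul_jac_eq_zero_of_adj (hM : M.SmoothPositive) (hA2 : M.SufficientChanges)
    (hsub : range M.g ⊆ range M'.g) (h : M'.Matches M) {k l : Fin n} (hkl : k ≠ l)
    (hadj : ¬ M'.markovNetwork.Adj k l) {y : Fin n → ℝ} (hy : y ∈ M.recoveredDomain M')
    {i j : Fin n} (hij : M.markovNetwork.Adj i j) : M.jac M' y i k * M.jac M' y j l = 0 := by
  have hsum : M.jac M' y i k * M.jac M' y j l + M.jac M' y j k * M.jac M' y i l = 0 := by
    rcases lt_or_gt_of_ne hij.ne with hlt | hlt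
    · exact congrFun (mixedCoeff_eq_zero hM hA2 hsub h hkl hadj hy) (.inr (.inr ⟨(i, j), hij, hlt⟩))
    · rw [add_comm]
      exact congrFun (mixedCoeff_eq_zero hM hA2 hsub h hkl hadj hy)
        (.inr (.inr ⟨(j, i), hij.symm, hlt⟩))
  have hi := jac_mul_jac_eq_zero hM hA2 hsub h hkl hadj hy i
  by_contra hne
  rw [(mul_eq_zero.1 hi).resolve_left (left_ne_zero_of_mul hne), mul_zero, add_zero] at hsum
  exact hne hsum

end Model

/-! ### Combinatorics of the nonzero pattern of the Jacobian. -/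

section Graph

variable {n : ℕ} {G G' : SimpleGraph (Fin n)} {D : Fin n → Fin n → ℝ} {ρ τ : Equiv.Perm (Fin n)}

/-- Some term of the Leibniz expansion of the determinant is nonzero. -/
theorem exists_perm_forall_ne_zero (hD : (Matrix.of D).det ≠ 0) :
    ∃ ρ : Equiv.Perm (Fin n), ∀ m, D (ρ m) m ≠ 0 := by
  by_contra! h
  refine hD ?_
  rw [Matrix.det_apply]
  refine Finset.sum_eq_zero fun ρ _ => ?_
  obtain ⟨m, hm⟩ := h ρ
  rw [Finset.prod_eq_zero (f := fun m => Matrix.of D (ρ m) m) (Finset.mem_univ m) hm, smul_zero]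

/-- If a bijection of the vertices maps non-edges to non-edges and the target has at least as many
edges, then it is an isomorphism. -/
theorem adj_iff_adj_of_ncard_le (h : ∀ k l, G.Adj (ρ k) (ρ l) → G'.Adj k l)
    (hcard : G'.edgeSet.ncard ≤ G.edgeSet.ncard) (k l : Fin n) :
    G'.Adj k l ↔ G.Adj (ρ k) (ρ l) := by
  have hle : G.comap ρ ≤ G' := fun k l hkl => h k l hkl
  have hc : (G.comap ρ).edgeSet.ncard = G.edgeSet.ncard :=
    Nat.card_congr (SimpleGraph.Iso.comap ρ G).mapEdgeSet
  have he := Set.eq_of_subset_of_ncard_le (SimpleGraph.edgeSet_mono hle) (hcard.trans hc.ge)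
  rw [← SimpleGraph.edgeSet_injective he]
  rfl

/-- The product of the entries of `D` at `(i, k)` and `(j, l)` vanishes if `i`, `j` are equal or
adjacent in `G`, and `k`, `l` are neither equal nor adjacent in `G'`. -/
def IsGraphCompatible (G G' : SimpleGraph (Fin n)) (D : Fin n → Fin n → ℝ) : Prop :=
  ∀ k l, k ≠ l → ¬ G'.Adj k l → ∀ i j, (i = j ∨ G.Adj i j) → D i k * D j l = 0

theorem IsGraphCompatible.adj_iff (hD : IsGraphCompatible G G' D)
    (hcard : G'.edgeSet.ncard ≤ G.edgeSet.ncard) (hρ : ∀ m, D (ρ m) m ≠ 0) (k l : Fin n) :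
    G'.Adj k l ↔ G.Adj (ρ k) (ρ l) := by
  refine adj_iff_adj_of_ncard_le (fun k l hkl => ?_) hcard k l
  by_contra hadj
  exact mul_ne_zero (hρ k) (hρ l)
    (hD k l (fun h => hkl.ne (congrArg ρ h)) hadj _ _ (.inr hkl))

/-- A nonzero entry of a compatible matrix means an inclusion of closed neighborhoods. -/
theorem IsGraphCompatible.insert_neighborSet_subset (hD : IsGraphCompatible G G' D)
    (hcard : G'.edgeSet.ncard ≤ G.edgeSet.ncard) (hρ : ∀ m, D (ρ m) m ≠ 0) {i k : Fin n}
    (hk : D i k ≠ 0) :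
    insert (ρ.symm i) (G'.neighborSet (ρ.symm i)) ⊆ insert k (G'.neighborSet k) := by
  intro a ha
  by_contra hka
  have hka' : a ≠ k ∧ ¬ G'.Adj k a := by simpa using hka
  refine mul_ne_zero hk (hρ a) (hD k a hka'.1.symm hka'.2 _ _ ?_)
  rcases ha with rfl | ha
  · exact .inl (ρ.apply_symm_apply i).symm
  · refine .inr ?_
    have := (hD.adj_iff hcard hρ _ _).1 ha
    rwa [ρ.apply_symm_apply] at this

/-- The entry at `(i, τ⁻¹ i)` is nonzero, which gives one inclusion; the other is symmetric. So the
closed neighborhood attached to `i` is independent of the permutation. -/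
theorem IsGraphCompatible.insert_neighborSet_eq (hD : IsGraphCompatible G G' D)
    (hcard : G'.edgeSet.ncard ≤ G.edgeSet.ncard) (hρ : ∀ m, D (ρ m) m ≠ 0)
    (hτ : ∀ m, D (τ m) m ≠ 0) (i : Fin n) :
    insert (ρ.symm i) (G'.neighborSet (ρ.symm i)) =
      insert (τ.symm i) (G'.neighborSet (τ.symm i)) := by
  refine (hD.insert_neighborSet_subset hcard hρ ?_).antisymm
    (hD.insert_neighborSet_subset hcard hτ ?_)
  · have := hτ (τ.symm i)
    rwa [τ.apply_symm_apply] at this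
  · have := hρ (ρ.symm i)
    rwa [ρ.apply_symm_apply] at this

/-- For a continuous family of invertible compatible matrices on a preconnected set, the pattern of
nonzero entries is compatible with the graphs even across different points. -/
theorem eq_or_adj_of_isPreconnected {X : Type*} [TopologicalSpace X] {W : Set X}
    (hW : IsPreconnected W) {D : X → Fin n → Fin n → ℝ}
    (hcont : ∀ i k, ContinuousOn (fun y => D y i k) W)
    (hdet : ∀ y ∈ W, (Matrix.of (D y)).det ≠ 0)
    (hD : ∀ y ∈ W, IsGraphCompatible G G' (D y))
    (hcard : G'.edgeSet.ncard ≤ G.edgeSet.ncard) {y y' : X} (hy : y ∈ W) (hy' : y' ∈ W)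
    {i j k l : Fin n} (hij : i = j ∨ G.Adj i j) (hik : D y i k ≠ 0) (hjl : D y' j l ≠ 0) :
    k = l ∨ G'.Adj k l := by
  choose! ρ hρ using fun y hy => exists_perm_forall_ne_zero (hdet y hy)
  let Φ : X → Fin n → Set (Fin n) := fun y i =>
    insert ((ρ y).symm i) (G'.neighborSet ((ρ y).symm i))
  have hconst : Φ y = Φ y' := by
    refine hW.induction₂ (fun x y => Φ x = Φ y) (fun x hx => ?_)
      (fun x y z _ _ _ h h' => h.trans h') (fun x y _ _ h => h.symm) hy hy'
    -- Finitely many nonzero entries stay nonzero nearby, so the permutation chosen at `x` also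
    -- serves at `z`.
    have hev : ∀ᶠ z in nhdsWithin x W, ∀ m, D z (ρ x m) m ≠ 0 :=
      Filter.eventually_all.2 fun m => (hcont _ _ x hx).eventually_ne (hρ x hx m)
    filter_upwards [hev, self_mem_nhdsWithin] with z hz hzW
    exact funext fun i => (hD z hzW).insert_neighborSet_eq hcard hz (hρ z hzW) i
  have h1 := (hD y hy).insert_neighborSet_subset hcard (hρ y hy) hik
  have h2 := (hD y' hy').insert_neighborSet_subset hcard (hρ y' hy') hjl
  -- The permutation at `y` is an isomorphism, so it carries the relation between `i` and `j` back
  -- to `G'`.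
  have h3 : (ρ y).symm j ∈ insert ((ρ y).symm i) (G'.neighborSet ((ρ y).symm i)) := by
    rcases hij with rfl | hij
    · exact mem_insert ..
    · refine mem_insert_of_mem _ (((hD y hy).adj_iff hcard (hρ y hy) _ _).2 ?_)
      simpa using hij
  have h4 : k ∈ Φ y j := by
    rcases h1 h3 with h | h
    · exact .inl h.symm
    · exact .inr (G'.adj_symm h)
  rw [hconst] at h4
  rcases h2 h4 with h | h
  · exact .inl h
  · exact .inr (G'.adj_symm h)

end Graph

/-- Across all values of the recovered latent variables: if `Z_i` is a function of `Ẑ_k` and `Z_j` is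
a function of `Ẑ_l`, where `Z_i`, `Z_j` are equal or adjacent, then `Ẑ_k`, `Ẑ_l` are equal or
adjacent. -/
theorem Model.eq_or_adj_of_isFunctionOf {ι : Type*} {n d : ℕ} {M M' : Model ι n d}
    (hA1 : M.SmoothPositive) (hA2 : M.SufficientChanges) (hmin : M'.IsMinimalMatch M)
    {i j k l : Fin n} (hij : i = j ∨ M.markovNetwork.Adj i j)
    (hik : M.IsFunctionOf M' i k) (hjl : M.IsFunctionOf M' j l) :
    k = l ∨ M'.markovNetwork.Adj k l := by
  have : Nonempty ι := (hA2 0).elim fun θ _ => ⟨θ 0⟩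
  have hsub := hA1.range_subset hmin.1
  obtain ⟨y, hy, hne⟩ := exists_jac_ne_zero hsub hik
  obtain ⟨y', hy', hne'⟩ := exists_jac_ne_zero hsub hjl
  -- The edge bound comes from minimality, as `M` matches itself.
  refine eq_or_adj_of_isPreconnected (isPreconnected_recoveredDomain hsub)
    (fun i k x hx => (continuousAt_jac hsub hx i k).continuousWithinAt)
    (fun x hx => det_jac_ne_zero hsub hx) (fun x hx k l hkl hadj i j hij => ?_)
    (hmin.2 M fun _ _ _ => rfl) hy hy' hij hne hne'
  rcases hij with rfl | hij
  · exact jac_mul_jac_eq_zero hA1 hA2 hsub hmin.1 hkl hadj hx i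
  · exact jac_mul_jac_eq_zero_of_adj hA1 hA2 hsub hmin.1 hkl hadj hx hij

end CausalRep

theorem mainTheorem3 {ι : Type*} {n d : ℕ} (M M' : CausalRep.Model ι n d)
    (hA1 : M.SmoothPositive) (hA2 : M.SufficientChanges) (hmin : M'.IsMinimalMatch M)
    (k l : Fin n) (hkl : k ≠ l) (hadj : ¬ M'.markovNetwork.Adj k l) :
    (∀ i, ¬ (M.IsFunctionOf M' i k ∧ M.IsFunctionOf M' i l)) ∧
    (∀ i j, M.markovNetwork.Adj i j →
      ¬ (M.IsFunctionOf M' i k ∧ M.IsFunctionOf M' j l) ∧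
      ¬ (M.IsFunctionOf M' i l ∧ M.IsFunctionOf M' j k)) := by
  have key : ∀ i j, (i = j ∨ M.markovNetwork.Adj i j) →
      ¬ (M.IsFunctionOf M' i k ∧ M.IsFunctionOf M' j l) := fun i j hij h =>
    not_or.2 ⟨hkl, hadj⟩ (CausalRep.Model.eq_or_adj_of_isFunctionOf hA1 hA2 hmin hij h.1 h.2)
  exact ⟨fun i => key i i (.inl rfl), fun i j hij =>
    ⟨key i j (.inr hij), fun h => key j i (.inr hij.symm) h.symm⟩⟩
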